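/- Let $V$ be a finite-dimensional complex vector space. Let $\mathrm{Lie}(V)$ be the Lie subalgebra, for the commutator bracket, generated by $V$ in the tensor algebra $\bigoplus_k V^{\otimes k}$, and put $\mathrm{Lie}^iV=\mathrm{Lie}(V)\cap V^{\otimes i}$. For a partition $\lambda$ of $k$ of length $\ell$ let $P(\lambda)$ be the set of distinct permutations of $\lambda$, and let $$W_\lambda(V)=\operatorname{span}\Big\{\sum_{\alpha\in P(\lambda)}T_{\alpha_1}\otimes\cdots\otimes T_{\alpha_\ell}\ \Big|\ T_i\in\mathrm{Lie}^iV \text{ for all } i\Big\}\subseteq V^{\otimes k}.$$ Let $\mathbb T(V^*)=\bigoplus_{k\ge 0}(V^{\otimes k})^*$, with the bilinear shuffle product given, for $\beta\in(V^{\otimes k})^*$ and $\gamma\in(V^{\otimes l})^*$, by $$(\beta\mathbin{\sqcup\!\sqcup}\gamma)(v_1\otimes\cdots\otimes v_{k+l})=\sum\beta(v_{i_1}\otimes\cdots\otimes v_{i_k})\,\gamma(v_{j_1}\otimes\cdots\otimes v_{j_l}),$$ where the sum is over all $i_1<\dots<i_k$ and $j_1<\dots<j_l$ with $\{i_1,\dots,i_k\}\sqcup\{j_1,\dots,j_l\}=\{1,\dots,k+l\}$.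 For a partition $\lambda$ of $k$, let $W_\lambda(V^*)\subseteq\mathbb T(V^*)$ be the space of those linear functions that only depend on $W_\lambda(V)$, that is, that vanish on $W_\mu(V)$ for every partition $\mu\neq\lambda$ (of any non-negative integer). For partitions $\lambda,\mu$ let $\lambda\cup\mu$ be the partition in which each $i$ occurs as often as it occurs in $\lambda$ and in $\mu$ together. Then the shuffle algebra $\mathbb T(V^*)$ is graded by partitions: 1. $\mathbb T(V^*)=\bigoplus_{\lambda}W_\lambda(V^*)$, the (internal) direct sum over all partitions $\lambda$ of all non-negative integers; 2. the unit of the shuffle algebra, which is the linear function $V^{\otimes 0}=\mathbb C\to\mathbb C$, $1\mapsto 1$, lies in $W_\emptyset(V^*)$; 3. if $\beta\in W_\lambda(V^*)$ and $\gamma\in W_\mu(V^*)$, then $\beta\mathbin{\sqcup\!\sqcup}\gamma\in W_{\lambda\cup\mu}(V^*)$. -/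

import Mathlib

open scoped DirectSum TensorProduct

noncomputable section

namespace Thrall

variable (V : Type*) [AddCommGroup V] [Module ℂ V]

attribute [local instance 100] LieRing.ofAssociativeRing

/-- The free Lie algebra `Lie(V)`: the Lie subalgebra of the tensor algebra (with the commutator
bracket) generated by `V`. -/
def freeLie : LieSubalgebra ℂ (TensorAlgebra ℂ V) :=
  LieSubalgebra.lieSpan ℂ (TensorAlgebra ℂ V) (Set.range (TensorAlgebra.ι ℂ : V → TensorAlgebra ℂ V))

/-- `Lie^k V = Lie(V) ∩ V^{⊗k}`, as a subspace of `V^{⊗k}`. -/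
def liePart (k : ℕ) : Submodule ℂ (⨂[ℂ]^k V) :=
  (freeLie V).toSubmodule.comap (TensorPower.toTensorAlgebra (R := ℂ) (M := V) (n := k))

/-- The Thrall module `W_p(V)` of a partition `p` of `k`, as a subspace of `V^{⊗k}`: the span of the
tensors `∑_α T_{α₁} ⊗ ⋯ ⊗ T_{α_ℓ}`, where `α` runs over the distinct permutations of `p`
and `T_i ∈ Lie^i V`. The products are computed in the tensor algebra, which contains `V^{⊗k}`. -/
def thrallModule {k : ℕ} (p : k.Partition) : Submodule ℂ (⨂[ℂ]^k V) :=
  Submodule.span ℂ {t | ∃ T : (i : ℕ) → ⨂[ℂ]^i V, (∀ i, T i ∈ liePart V i) ∧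
    TensorPower.toTensorAlgebra t =
      ∑ α ∈ p.parts.lists.toFinset, (α.map fun i => TensorPower.toTensorAlgebra (T i)).prod}

/-- The space `𝕋(V*) = ⨁_k (V^{⊗k})*`, the graded dual of the tensor algebra. -/
abbrev ShuffleAlgebra : Type _ := ⨁ k : ℕ, Module.Dual ℂ (⨂[ℂ]^k V)

/-- The space `W_p(V*) ⊆ 𝕋(V*)` of the linear functions that only depend on `W_p(V)`: those that
vanish on `W_q(V)` for every partition `q` (of any natural number) other than `p`. -/
def dualThrallModule {k : ℕ} (p : k.Partition) : Submodule ℂ (ShuffleAlgebra V) where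
  carrier := {β | ∀ (m : ℕ) (q : m.Partition), q.parts ≠ p.parts →
    ∀ t ∈ thrallModule V q, β m t = 0}
  add_mem' := fun {a b} ha hb m q hq t ht => by
    simp [DirectSum.add_apply, ha m q hq t ht, hb m q hq t ht]
  zero_mem' := fun m q hq t ht => by simp
  smul_mem' := fun c a ha m q hq t ht => by
    simp [DirectSum.smul_apply, ha m q hq t ht]

variable {V}

/-- The partition `p ∪ q`: each `i` occurs in it as often as in `p` and in `q` together. -/
def partitionUnion {k l : ℕ} (p : k.Partition) (q : l.Partition) : (k + l).Partition where
  parts := p.parts + q.parts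
  parts_pos := fun {i} hi => by
    rcases Multiset.mem_add.1 hi with h | h
    · exact p.parts_pos h
    · exact q.parts_pos h
  parts_sum := by rw [Multiset.sum_add, p.parts_sum, q.parts_sum]

lemma card_compl_eq {k l : ℕ} (s : {s : Finset (Fin (k + l)) // s.card = k}) :
    (s.1ᶜ).card = l := by
  rw [Finset.card_compl, s.2, Fintype.card_fin]; omega

/-- The function `(v₁, …, v_{k+l}) ↦ ∑ β(v_{i₁} ⊗ ⋯ ⊗ v_{i_k}) γ(v_{j₁} ⊗ ⋯ ⊗ v_{j_l})`, the sum over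
all `i₁ < ⋯ < i_k` and `j₁ < ⋯ < j_l` with `{i₁, …, i_k} ⊔ {j₁, …, j_l} = {1, …, k + l}`. -/
def shuffleMultilinear {k l : ℕ} (β : Module.Dual ℂ (⨂[ℂ]^k V)) (γ : Module.Dual ℂ (⨂[ℂ]^l V)) :
    MultilinearMap ℂ (fun _ : Fin (k + l) => V) ℂ :=
  ∑ s : {s : Finset (Fin (k + l)) // s.card = k},
    (LinearMap.mul' ℂ ℂ).compMultilinearMap
      (((β.compMultilinearMap (PiTensorProduct.tprod ℂ)).domCoprod
        (γ.compMultilinearMap (PiTensorProduct.tprod ℂ))).domDomCongr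
          (finSumEquivOfFinset s.2 (card_compl_eq s)))

lemma shuffleMultilinear_apply {k l : ℕ} (β : Module.Dual ℂ (⨂[ℂ]^k V))
    (γ : Module.Dual ℂ (⨂[ℂ]^l V)) (v : Fin (k + l) → V) :
    shuffleMultilinear β γ v = ∑ s : {s : Finset (Fin (k + l)) // s.card = k},
      β (PiTensorProduct.tprod ℂ fun a => v (s.1.orderEmbOfFin s.2 a)) *
        γ (PiTensorProduct.tprod ℂ fun b => v (s.1ᶜ.orderEmbOfFin (card_compl_eq s) b)) := by
  simp [shuffleMultilinear]

/-- The shuffle product `β ⧢ γ` of homogeneous elements, a linear function on `V^{⊗(k+l)}`. -/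
def shuffleHom (k l : ℕ) : Module.Dual ℂ (⨂[ℂ]^k V) →ₗ[ℂ] Module.Dual ℂ (⨂[ℂ]^l V) →ₗ[ℂ]
    Module.Dual ℂ (⨂[ℂ]^(k + l) V) :=
  LinearMap.mk₂ ℂ (fun β γ => PiTensorProduct.lift (shuffleMultilinear β γ))
    (fun β β' γ => by
      ext v; simp [shuffleMultilinear_apply, add_mul, Finset.sum_add_distrib])
    (fun c β γ => by
      ext v; simp [shuffleMultilinear_apply, mul_assoc, Finset.mul_sum])
    (fun β γ γ' => by
      ext v; simp [shuffleMultilinear_apply, mul_add, Finset.sum_add_distrib])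
    (fun c β γ => by
      ext v; simp [shuffleMultilinear_apply, mul_left_comm, Finset.mul_sum])

lemma shuffleHom_tprod {k l : ℕ} (β : Module.Dual ℂ (⨂[ℂ]^k V))
    (γ : Module.Dual ℂ (⨂[ℂ]^l V)) (v : Fin (k + l) → V) :
    shuffleHom k l β γ (PiTensorProduct.tprod ℂ v) =
      ∑ s : {s : Finset (Fin (k + l)) // s.card = k},
        β (PiTensorProduct.tprod ℂ fun a => v (s.1.orderEmbOfFin s.2 a)) *
          γ (PiTensorProduct.tprod ℂ fun b => v (s.1ᶜ.orderEmbOfFin (card_compl_eq s) b)) := by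
  simp [shuffleHom, shuffleMultilinear_apply]

/-- The shuffle product on `𝕋(V*)`, the bilinear extension of `shuffleHom`. -/
def shuffle : ShuffleAlgebra V →ₗ[ℂ] ShuffleAlgebra V →ₗ[ℂ] ShuffleAlgebra V :=
  DirectSum.toModule ℂ ℕ _ fun k => LinearMap.flip <| DirectSum.toModule ℂ ℕ _ fun l =>
    LinearMap.flip <| (shuffleHom k l).compr₂
      (DirectSum.lof ℂ ℕ (fun m => Module.Dual ℂ (⨂[ℂ]^m V)) (k + l))

lemma shuffle_lof {k l : ℕ} (β : Module.Dual ℂ (⨂[ℂ]^k V)) (γ : Module.Dual ℂ (⨂[ℂ]^l V)) :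
    shuffle (DirectSum.lof ℂ ℕ (fun m => Module.Dual ℂ (⨂[ℂ]^m V)) k β)
        (DirectSum.lof ℂ ℕ (fun m => Module.Dual ℂ (⨂[ℂ]^m V)) l γ) =
      DirectSum.lof ℂ ℕ (fun m => Module.Dual ℂ (⨂[ℂ]^m V)) (k + l) (shuffleHom k l β γ) := by
  simp [shuffle]

variable (V)

/-- The unit of the shuffle algebra: the linear function on `V^{⊗0}` with value `1` on the empty
tensor product. -/
def shuffleOne : ShuffleAlgebra V :=
  DirectSum.lof ℂ ℕ (fun m => Module.Dual ℂ (⨂[ℂ]^m V)) 0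
    (PiTensorProduct.isEmptyEquiv (Fin 0)).toLinearMap

end Thrall

end

/-! The tensor algebra is spanned by the symmetrized products `symSum T s` of homogeneous Lie
elements of positive degree, and linear operators can read off the type `s` of such a product. The
theorem is the dual of this.

Spanning (`span_symSum_liePart`): by polarization the powers of Lie elements span
(`span_pow_freeLie`), and a power of a sum of homogeneous Lie elements expands into symmetrized
products.

Separation of types needs no Poincaré–Birkhoff–Witt theorem. Lie elements are primitive for the
unshuffle coproduct, so the coproduct of `symSum T s` is a binomial sum over the splittings `a + b =
s` (`comul_symSum`). Multiplication after coproduct therefore scales it by `2 ^ s.card`.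
Independence of eigenspaces yields projections by number of factors, hence onto the Lie elements of
a given degree. Convolutions of these give `thrallProj r`, which fixes the products of type `r` and
kills all other types (`thrallProj_symSum`).

Composing a function with these projections splits it into its components, and a function is zero
once it vanishes on all types. The shuffle product is the transpose of the coproduct
(`pairing_shuffle`), so in `comul_symSum` only the splitting into the parts of `p` and the parts of
`q` can contribute; this is multiplicativity. -/

noncomputable section

namespace Thrall

/-! ### Symmetric products indexed by multisets -/

/-- The ordered pairs of multisets `(a, b)` with `a + b = s`, each listed once. -/
def splits (s : Multiset ℕ) : Finset (Multiset ℕ × Multiset ℕ) :=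
  (Multiset.antidiagonal s).toFinset

@[simp]
theorem mem_splits {s : Multiset ℕ} {x : Multiset ℕ × Multiset ℕ} :
    x ∈ splits s ↔ x.1 + x.2 = s := by
  simp [splits]

/-- A value may be removed from the left part after splitting, or from `s` before splitting; both
ways list the same triples. -/
theorem sum_splits_left {M : Type*} [AddCommMonoid M] (s : Multiset ℕ)
    (f : ℕ → Multiset ℕ → Multiset ℕ → M) :
    ∑ x ∈ splits s, ∑ i ∈ x.1.toFinset, f i (x.1.erase i) x.2 =
      ∑ i ∈ s.toFinset, ∑ x ∈ splits (s.erase i), f i x.1 x.2 := by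
  rw [Finset.sum_sigma', Finset.sum_sigma']
  refine Finset.sum_bij' (fun y _ => ⟨y.2, (y.1.1.erase y.2, y.1.2)⟩)
    (fun y _ => ⟨(y.1 ::ₘ y.2.1, y.2.2), y.1⟩) ?_ ?_ ?_ ?_ ?_
  · rintro ⟨⟨a, b⟩, i⟩ h
    simp only [Finset.mem_sigma, mem_splits, Multiset.mem_toFinset] at h ⊢
    obtain ⟨rfl, h⟩ := h
    exact ⟨Multiset.mem_add.2 (Or.inl h), (Multiset.erase_add_left_pos _ h).symm⟩
  · rintro ⟨i, ⟨a, b⟩⟩ h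
    simp only [Finset.mem_sigma, mem_splits, Multiset.mem_toFinset] at h ⊢
    refine ⟨?_, Multiset.mem_cons_self _ _⟩
    rw [Multiset.cons_add, h.2, Multiset.cons_erase h.1]
  · rintro ⟨⟨a, b⟩, i⟩ h
    simp only [Finset.mem_sigma, mem_splits, Multiset.mem_toFinset] at h
    simp [Multiset.cons_erase h.2]
  · rintro ⟨i, ⟨a, b⟩⟩ h
    simp
  · rintro ⟨⟨a, b⟩, i⟩ h
    rfl

theorem sum_splits_swap {M : Type*} [AddCommMonoid M] (s : Multiset ℕ)
    (f : Multiset ℕ → Multiset ℕ → M) :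
    ∑ x ∈ splits s, f x.1 x.2 = ∑ x ∈ splits s, f x.2 x.1 :=
  Finset.sum_bij' (fun x _ => x.swap) (fun x _ => x.swap)
    (fun x hx => by simpa [add_comm] using hx) (fun x hx => by simpa [add_comm] using hx)
    (fun _ _ => rfl) (fun _ _ => rfl) (fun _ _ => rfl)

theorem sum_splits_right {M : Type*} [AddCommMonoid M] (s : Multiset ℕ)
    (f : ℕ → Multiset ℕ → Multiset ℕ → M) :
    ∑ x ∈ splits s, ∑ i ∈ x.2.toFinset, f i x.1 (x.2.erase i) =
      ∑ i ∈ s.toFinset, ∑ x ∈ splits (s.erase i), f i x.1 x.2 := by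
  rw [sum_splits_swap s fun a b => ∑ i ∈ b.toFinset, f i a (b.erase i),
    sum_splits_left s fun i a b => f i b a]
  exact Finset.sum_congr rfl fun i _ => sum_splits_swap _ fun a b => f i b a

section Semiring

variable {A B : Type*} [Semiring A] [Semiring B]

/-- The sum of the products `T_{α₁} ⋯ T_{α_ℓ}` over the distinct orderings `α` of `s`. -/
def symSum (T : ℕ → A) (s : Multiset ℕ) : A :=
  ∑ α ∈ s.lists.toFinset, (α.map T).prod

@[simp]
theorem symSum_zero (T : ℕ → A) : symSum T 0 = 1 := by
  have : (0 : Multiset ℕ).lists.toFinset = {[]} := by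
    ext l
    simp [Multiset.mem_lists_iff, eq_comm]
  simp [symSum, this]

/-- Sorts the orderings by first letter. Orderings are counted once each, so `i` runs over distinct
values, without multiplicity. -/
theorem symSum_eq_sum_erase (T : ℕ → A) {s : Multiset ℕ} (hs : s ≠ 0) :
    symSum T s = ∑ i ∈ s.toFinset, T i * symSum T (s.erase i) := by
  simp only [symSum, Finset.mul_sum]
  rw [Finset.sum_sigma']
  refine Finset.sum_bij' (fun α _ => ⟨α.headI, α.tail⟩) (fun y _ => y.1 :: y.2) ?_ ?_ ?_ ?_ ?_
  · rintro (_ | ⟨i, α⟩) h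
    · exact absurd (by simpa [Multiset.mem_lists_iff] using h) hs
    · have h : s = i ::ₘ (α : Multiset ℕ) := by simpa [Multiset.mem_lists_iff] using h
      simp [h]
  · rintro ⟨i, α⟩ h
    simp only [Finset.mem_sigma, Multiset.mem_toFinset, Multiset.mem_lists_iff,
      Multiset.quot_mk_to_coe] at h ⊢
    rw [← Multiset.cons_coe, ← h.2, Multiset.cons_erase h.1]
  · rintro (_ | ⟨i, α⟩) h
    · exact absurd (by simpa [Multiset.mem_lists_iff] using h) hs
    · rfl
  · rintro ⟨i, α⟩ h
    rfl
  · rintro (_ | ⟨i, α⟩) h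
    · exact absurd (by simpa [Multiset.mem_lists_iff] using h) hs
    · simp

theorem sum_erase_symSum (T : ℕ → A) (s : Multiset ℕ) :
    ∑ i ∈ s.toFinset, T i * symSum T (s.erase i) = if s = 0 then 0 else symSum T s := by
  split_ifs with h
  · simp [h]
  · exact (symSum_eq_sum_erase T h).symm

theorem symSum_singleton (T : ℕ → A) (i : ℕ) : symSum T {i} = T i := by
  rw [symSum_eq_sum_erase T (Multiset.singleton_ne_zero i)]
  simp

theorem map_symSum (f : A →+* B) (T : ℕ → A) (s : Multiset ℕ) :
    f (symSum T s) = symSum (fun i => f (T i)) s := by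
  simp only [symSum, map_sum, map_list_prod, List.map_map]
  rfl

theorem commute_symSum {P : ℕ → A} {y : A} (h : ∀ i, Commute y (P i)) (s : Multiset ℕ) :
    Commute y (symSum P s) :=
  Commute.sum_right _ _ _ fun α _ => Commute.list_prod_right _ _ fun x hx => by
    obtain ⟨i, -, rfl⟩ := List.mem_map.1 hx
    exact h i

/-- A binomial theorem: a word in the `P i` and a word in the `Q j` have `s.card.choose x.1.card`
interleavings, all with the same product. -/
theorem symSum_add (P Q : ℕ → A) (h : ∀ i j, Commute (P i) (Q j)) (s : Multiset ℕ) :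
    symSum (fun i => P i + Q i) s =
      ∑ x ∈ splits s, (s.card.choose x.1.card) • (symSum P x.1 * symSum Q x.2) := by
  induction hn : s.card generalizing s with
  | zero =>
    obtain rfl := Multiset.card_eq_zero.1 hn
    simp [splits]
  | succ n ih =>
    have hs : s ≠ 0 := by rintro rfl; simp at hn
    have key : ∀ i ∈ s.toFinset, (P i + Q i) * symSum (fun i => P i + Q i) (s.erase i) =
        ∑ x ∈ splits (s.erase i), n.choose x.1.card • (P i * symSum P x.1 * symSum Q x.2) +
        ∑ x ∈ splits (s.erase i), n.choose x.1.card • (symSum P x.1 * (Q i * symSum Q x.2)) := by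
      intro i hi
      have hc : (s.erase i).card = n := by
        rw [Multiset.card_erase_of_mem (Multiset.mem_toFinset.1 hi), hn]; rfl
      rw [ih _ hc, add_mul, Finset.mul_sum, Finset.mul_sum]
      congr 1
      · refine Finset.sum_congr rfl fun x _ => ?_
        rw [mul_smul_comm, mul_assoc]
      · refine Finset.sum_congr rfl fun x _ => ?_
        rw [mul_smul_comm, ← mul_assoc, ← mul_assoc,
          (commute_symSum (fun j => (h j i).symm) x.1).eq]
    rw [symSum_eq_sum_erase _ hs, Finset.sum_congr rfl key, Finset.sum_add_distrib,
      ← sum_splits_left s fun i a b => n.choose a.card • (P i * symSum P a * symSum Q b),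
      ← sum_splits_right s fun i a b => n.choose a.card • (symSum P a * (Q i * symSum Q b)),
      ← Finset.sum_add_distrib]
    refine Finset.sum_congr rfl fun x hx => ?_
    obtain ⟨a, b⟩ := x
    rw [mem_splits] at hx
    dsimp only at hx ⊢
    have h1 : ∑ i ∈ a.toFinset, n.choose (a.erase i).card •
        (P i * symSum P (a.erase i) * symSum Q b) =
        n.choose (a.card - 1) • ((if a = 0 then 0 else symSum P a) * symSum Q b) := by
      rw [← sum_erase_symSum, Finset.sum_mul, Finset.smul_sum]
      refine Finset.sum_congr rfl fun i hi => ?_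
      rw [Multiset.card_erase_of_mem (Multiset.mem_toFinset.1 hi)]; rfl
    have h2 : ∑ i ∈ b.toFinset, n.choose a.card • (symSum P a * (Q i * symSum Q (b.erase i))) =
        n.choose a.card • (symSum P a * (if b = 0 then 0 else symSum Q b)) := by
      rw [← sum_erase_symSum, Finset.mul_sum, Finset.smul_sum]
    rw [h1, h2]
    by_cases ha : a = 0
    · subst ha
      have hb : b ≠ 0 := by rintro rfl; simp at hx; exact hs hx.symm
      simp [hb]
    · obtain ⟨m, hm⟩ : ∃ m, a.card = m + 1 :=
        ⟨a.card - 1, (Nat.succ_pred_eq_of_pos (Multiset.card_pos.2 ha)).symm⟩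
      -- Pascal's rule separates the interleavings beginning with a `P` from those beginning with a
      -- `Q`; for `b = 0` the second coefficient is zero.
      rw [if_neg ha, hm, Nat.choose_succ_succ, add_smul, Nat.add_sub_cancel]
      congr 1
      by_cases hb : b = 0
      · have : n = m := by
          have := congrArg Multiset.card hx
          simp [hb] at this
          omega
        simp [this]
      · rw [if_neg hb]

/-- Each ordering of `s` can be cut in exactly one way after its `j`-th letter, for every `j ≤
s.card`. The weight is arbitrary because the induction shifts it. -/
theorem sum_splits_symSum_mul (T : ℕ → A) (w : ℕ → ℕ) (s : Multiset ℕ) :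
    ∑ x ∈ splits s, w x.1.card • (symSum T x.1 * symSum T x.2) =
      (∑ j ∈ Finset.range (s.card + 1), w j) • symSum T s := by
  induction hn : s.card generalizing s w with
  | zero =>
    obtain rfl := Multiset.card_eq_zero.1 hn
    simp [splits]
  | succ n ih =>
    have hs : s ≠ 0 := by rintro rfl; simp at hn
    -- The first letter is peeled off the left factor; the splitting with empty left part has none
    -- and leaves the term `w 0`.
    have key : ∀ x ∈ splits s, w x.1.card • (symSum T x.1 * symSum T x.2) =
        (if x = (0, s) then w 0 • symSum T s else 0) + ∑ i ∈ x.1.toFinset,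
          w ((x.1.erase i).card + 1) • (T i * symSum T (x.1.erase i) * symSum T x.2) := by
      rintro ⟨a, b⟩ hx
      rw [mem_splits] at hx
      dsimp only at hx ⊢
      have h1 : ∑ i ∈ a.toFinset, w ((a.erase i).card + 1) •
          (T i * symSum T (a.erase i) * symSum T b) =
          w a.card • ((if a = 0 then 0 else symSum T a) * symSum T b) := by
        rw [← sum_erase_symSum, Finset.sum_mul, Finset.smul_sum]
        refine Finset.sum_congr rfl fun i hi => ?_
        rw [Multiset.card_erase_add_one (Multiset.mem_toFinset.1 hi)]
      rw [h1]
      by_cases ha : a = 0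
      · subst ha
        obtain rfl : b = s := by simpa using hx
        simp
      · simp [ha]
    rw [Finset.sum_congr rfl key, Finset.sum_add_distrib,
      sum_splits_left s fun i a b => w (a.card + 1) • (T i * symSum T a * symSum T b),
      Finset.sum_ite_eq' (splits s) (0, s), if_pos (by simp)]
    have h2 : ∀ i ∈ s.toFinset, ∑ x ∈ splits (s.erase i),
        w (x.1.card + 1) • (T i * symSum T x.1 * symSum T x.2) =
        (∑ j ∈ Finset.range (n + 1), w (j + 1)) • (T i * symSum T (s.erase i)) := by
      intro i hi
      have hc : (s.erase i).card = n := by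
        rw [Multiset.card_erase_of_mem (Multiset.mem_toFinset.1 hi), hn]; rfl
      rw [← mul_smul_comm, ← ih (fun j => w (j + 1)) _ hc, Finset.mul_sum]
      exact Finset.sum_congr rfl fun x _ => by rw [mul_smul_comm, mul_assoc]
    rw [Finset.sum_congr rfl h2, ← Finset.smul_sum, ← symSum_eq_sum_erase T hs,
      Finset.sum_range_succ' w, add_smul, add_comm]

theorem sum_splits_choose_symSum_mul (T : ℕ → A) (s : Multiset ℕ) :
    ∑ x ∈ splits s, s.card.choose x.1.card • (symSum T x.1 * symSum T x.2) =
      2 ^ s.card • symSum T s := by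
  rw [sum_splits_symSum_mul, Nat.sum_range_choose]

/-- The multisets of cardinality `n` with elements in `I`. -/
def multisetsOfCard (I : Finset ℕ) (n : ℕ) : Finset (Multiset ℕ) :=
  (I.sym n).map ⟨Sym.toMultiset, Sym.coe_injective⟩

theorem mem_multisetsOfCard {I : Finset ℕ} {n : ℕ} {s : Multiset ℕ} :
    s ∈ multisetsOfCard I n ↔ s.card = n ∧ ∀ i ∈ s, i ∈ I := by
  simp only [multisetsOfCard, Finset.mem_map, Finset.mem_sym_iff, Function.Embedding.coeFn_mk]
  constructor
  · rintro ⟨m, hm, rfl⟩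
    exact ⟨m.2, hm⟩
  · rintro ⟨h, hs⟩
    exact ⟨⟨s, h⟩, hs, rfl⟩

theorem sum_pow_eq_sum_symSum (T : ℕ → A) (I : Finset ℕ) (n : ℕ) :
    (∑ i ∈ I, T i) ^ n = ∑ s ∈ multisetsOfCard I n, symSum T s := by
  induction n with
  | zero =>
    have : multisetsOfCard I 0 = {0} := by
      ext s
      simp only [mem_multisetsOfCard, Multiset.card_eq_zero, Finset.mem_singleton]
      exact ⟨fun h => h.1, fun h => ⟨h, by simp [h]⟩⟩
    simp [this]
  | succ n ih =>
    rw [pow_succ', ih, Finset.sum_mul_sum, Finset.sum_congr rfl fun s hs =>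
      symSum_eq_sum_erase T (s := s) fun h => by
        simp [h, mem_multisetsOfCard] at hs]
    rw [Finset.sum_sigma', Finset.sum_sigma']
    refine Finset.sum_bij' (fun y _ => ⟨y.1 ::ₘ y.2, y.1⟩) (fun y _ => ⟨y.2, y.1.erase y.2⟩)
      ?_ ?_ ?_ ?_ ?_
    · rintro ⟨i, s⟩ h
      simp only [Finset.mem_sigma, mem_multisetsOfCard] at h ⊢
      obtain ⟨h1, h2, h3⟩ := h
      refine ⟨⟨by simp [h2], fun j hj => ?_⟩, by simp⟩
      rcases Multiset.mem_cons.1 hj with rfl | hj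
      exacts [h1, h3 j hj]
    · rintro ⟨s, i⟩ h
      simp only [Finset.mem_sigma, mem_multisetsOfCard, Multiset.mem_toFinset] at h ⊢
      obtain ⟨⟨h1, h2⟩, h3⟩ := h
      exact ⟨h2 i h3, by rw [Multiset.card_erase_of_mem h3, h1]; rfl,
        fun j hj => h2 j (Multiset.mem_of_mem_erase hj)⟩
    · rintro ⟨i, s⟩ h
      simp
    · rintro ⟨s, i⟩ h
      simp only [Finset.mem_sigma, mem_multisetsOfCard, Multiset.mem_toFinset] at h
      simp [Multiset.cons_erase h.2]
    · rintro ⟨i, s⟩ h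
      simp

end Semiring

attribute [local instance 100] LieRing.ofAssociativeRing

/-! ### Powers of Lie elements span -/

/-- Modulo `W`, every functional turns the curve into a polynomial vanishing on all of `ℂ`, so its
coefficients vanish. -/
theorem coeff_mem_of_forall_sum_mem {M : Type*} [AddCommGroup M] [Module ℂ M]
    (W : Submodule ℂ M) (N : ℕ) (u : ℕ → M)
    (h : ∀ c : ℂ, ∑ j ∈ Finset.range N, c ^ j • u j ∈ W) {j : ℕ} (hj : j < N) : u j ∈ W := by
  rw [← Submodule.Quotient.mk_eq_zero, ← Module.forall_dual_apply_eq_zero_iff ℂ]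
  intro φ
  set p : Polynomial ℂ := ∑ i ∈ Finset.range N,
    Polynomial.monomial i (φ (Submodule.Quotient.mk (u i))) with hp
  have hp0 : p = 0 := by
    refine Polynomial.funext fun c => ?_
    have := congrArg φ ((Submodule.Quotient.mk_eq_zero W).2 (h c))
    rw [← W.mkQ_apply, map_sum, map_sum, map_zero] at this
    rw [hp, Polynomial.eval_finsetSum, Polynomial.eval_zero, ← this]
    refine Finset.sum_congr rfl fun i _ => ?_
    simp [mul_comm]
  have := congrArg (fun q => Polynomial.coeff q j) hp0
  simpa [hp, Polynomial.finsetSum_coeff, Polynomial.coeff_monomial, hj] using this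

section Algebra

variable {A : Type*} [Ring A] [Algebra ℂ A]

theorem exists_coeff_add_smul_pow (x y : A) (n : ℕ) :
    ∃ (N : ℕ) (u : ℕ → A), 1 < N ∧ (∀ j, N ≤ j → u j = 0) ∧ u 0 = x ^ n ∧
      u 1 = ∑ a ∈ Finset.range n, x ^ a * y * x ^ (n - 1 - a) ∧
      ∀ c : ℂ, (x + c • y) ^ n = ∑ j ∈ Finset.range N, c ^ j • u j := by
  induction n with
  | zero =>
    refine ⟨2, fun j => if j = 0 then 1 else 0, by norm_num, ?_, by simp, by simp, ?_⟩
    · intro j hj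
      exact if_neg (by omega)
    · intro c
      simp
  | succ n ih =>
    obtain ⟨N, u, hN, hu, h0, h1, hc⟩ := ih
    refine ⟨N + 1, fun j => x * u j + (if j = 0 then 0 else y * u (j - 1)), by omega, ?_, ?_, ?_, ?_⟩
    · intro j hj
      dsimp only
      rw [hu j (by omega), hu (j - 1) (by omega)]
      simp
    · simp [h0, pow_succ']
    · dsimp only
      rw [Finset.sum_range_succ', h1, Finset.mul_sum]
      simp only [one_ne_zero, if_false, Nat.sub_self, h0, Nat.add_sub_cancel, pow_zero, one_mul,
        Nat.sub_zero]
      congr 1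
      refine Finset.sum_congr rfl fun a _ => ?_
      rw [pow_succ', mul_assoc, mul_assoc, mul_assoc, Nat.sub_sub, add_comm 1 a]
    · intro c
      rw [pow_succ', hc, add_mul]
      simp only [smul_add, Finset.sum_add_distrib]
      congr 1
      · rw [Finset.sum_range_succ, hu N le_rfl, Finset.mul_sum]
        simp
      · rw [Finset.sum_range_succ', Finset.mul_sum]
        simp [pow_succ, mul_smul]

variable (L : LieSubalgebra ℂ A)

/-- The span of the powers `x ^ m` of elements of `L` with `m ≤ n`. -/
def powSpan (n : ℕ) : Submodule ℂ A :=
  Submodule.span ℂ {z | ∃ x ∈ L, ∃ m ≤ n, z = x ^ m}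

theorem powSpan_mono {m n : ℕ} (h : m ≤ n) : powSpan L m ≤ powSpan L n :=
  Submodule.span_mono fun _ ⟨x, hx, k, hk, hz⟩ => ⟨x, hx, k, hk.trans h, hz⟩

theorem pow_mem_powSpan {x : A} (hx : x ∈ L) {m n : ℕ} (h : m ≤ n) : x ^ m ∈ powSpan L n :=
  Submodule.subset_span ⟨x, hx, m, h, rfl⟩

theorem mem_one_sup {x : A} (hx : x ∈ L) : x ∈ (1 ⊔ L.toSubmodule : Submodule ℂ A) :=
  le_sup_right (a := (1 : Submodule ℂ A)) hx

/-- Moving `y` left past one `x` costs a commutator, which lies in `L` and so saves one factor. -/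
theorem pow_mul_mul_pow_sub_mem {x y : A} (hx : x ∈ L) (hy : y ∈ L) (a b : ℕ) :
    x ^ a * y * x ^ b - y * x ^ (a + b) ∈ (1 ⊔ L.toSubmodule : Submodule ℂ A) ^ (a + b) := by
  induction a generalizing b with
  | zero => simp
  | succ a ih =>
    have h1 := ih (b + 1)
    have h2 : x ^ a * ⁅x, y⁆ * x ^ b ∈ (1 ⊔ L.toSubmodule : Submodule ℂ A) ^ (a + 1 + b) := by
      rw [pow_add, pow_add, pow_one]
      exact Submodule.mul_mem_mul (Submodule.mul_mem_mul (Submodule.pow_mem_pow _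
        (mem_one_sup L hx) _) (mem_one_sup L (L.lie_mem hx hy)))
        (Submodule.pow_mem_pow _ (mem_one_sup L hx) _)
    rw [show a + (b + 1) = a + 1 + b by omega] at h1
    convert add_mem h1 h2 using 1
    rw [Ring.lie_def, pow_succ x a, pow_succ' x b]
    noncomm_ring

/-- Polarization: modulo products with fewer factors, `y * x ^ m` is the average of the products `x
^ a * y * x ^ (m - a)`, whose sum is the linear coefficient in `c` of `(x + c • y) ^ (m + 1)`. -/
theorem one_sup_pow_le_powSpan (n : ℕ) :
    (1 ⊔ L.toSubmodule : Submodule ℂ A) ^ n ≤ powSpan L n := by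
  induction n with
  | zero =>
    rw [pow_zero, Submodule.one_le]
    simpa using pow_mem_powSpan L (zero_mem L) (le_refl 0)
  | succ n ih =>
    rw [pow_succ']
    refine (mul_le_mul_right ih _).trans ?_
    rw [Submodule.sup_mul, one_mul]
    refine sup_le (powSpan_mono L (Nat.le_succ n)) ?_
    rw [powSpan, ← Submodule.span_eq L.toSubmodule, Submodule.span_mul_span, Submodule.span_le]
    rintro _ ⟨y, hy, _, ⟨x, hx, m, hm, rfl⟩, rfl⟩
    change y ∈ L at hy
    change y * x ^ m ∈ powSpan L (n + 1)
    rcases Nat.lt_or_eq_of_le hm with hm | rfl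
    · refine powSpan_mono L (Nat.le_succ n) (ih ?_)
      have h1 : y * x ^ m ∈ (1 ⊔ L.toSubmodule : Submodule ℂ A) ^ (m + 1) := by
        rw [pow_succ']
        exact Submodule.mul_mem_mul (mem_one_sup L hy)
          (Submodule.pow_mem_pow _ (mem_one_sup L hx) _)
      exact pow_le_pow_right₀ (a := (1 ⊔ L.toSubmodule : Submodule ℂ A)) le_sup_left hm h1
    · obtain ⟨N, u, hN, -, -, hu, hc⟩ := exists_coeff_add_smul_pow x y (m + 1)
      have h1 : u 1 ∈ powSpan L (m + 1) := by
        refine coeff_mem_of_forall_sum_mem _ N u (fun c => ?_) hN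
        rw [← hc]
        exact pow_mem_powSpan L (add_mem hx (L.smul_mem c hy)) le_rfl
      have h2 : ∑ a ∈ Finset.range (m + 1), (x ^ a * y * x ^ (m - a) - y * x ^ m) ∈
          powSpan L (m + 1) := by
        refine powSpan_mono L (Nat.le_succ m) (sum_mem fun a ha => ih ?_)
        have := pow_mul_mul_pow_sub_mem L hx hy a (m - a)
        rwa [Nat.add_sub_cancel' (Nat.lt_succ_iff.1 (Finset.mem_range.1 ha))] at this
      have h3 := sub_mem h1 h2
      rw [hu, Nat.add_sub_cancel, ← Finset.sum_sub_distrib] at h3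
      simp only [sub_sub_cancel, Finset.sum_const, Finset.card_range] at h3
      rw [← Nat.cast_smul_eq_nsmul ℂ] at h3
      exact (Submodule.smul_mem_iff _ (by exact_mod_cast Nat.succ_ne_zero m)).1 h3

end Algebra

variable {V : Type*} [AddCommGroup V] [Module ℂ V]

theorem ι_mem_freeLie (v : V) : TensorAlgebra.ι ℂ v ∈ freeLie V :=
  LieSubalgebra.subset_lieSpan ⟨v, rfl⟩

theorem exists_mem_one_sup_freeLie_pow (z : TensorAlgebra ℂ V) :
    ∃ n, z ∈ (1 ⊔ (freeLie V).toSubmodule : Submodule ℂ (TensorAlgebra ℂ V)) ^ n := by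
  have hone : (1 : Submodule ℂ (TensorAlgebra ℂ V)) ≤ 1 ⊔ (freeLie V).toSubmodule := le_sup_left
  induction z using TensorAlgebra.induction with
  | algebraMap r => exact ⟨0, by rw [pow_zero]; exact Submodule.algebraMap_mem r⟩
  | ι v => exact ⟨1, by rw [pow_one]; exact mem_one_sup _ (ι_mem_freeLie v)⟩
  | mul a b ha hb =>
    obtain ⟨m, hm⟩ := ha
    obtain ⟨n, hn⟩ := hb
    exact ⟨m + n, by rw [pow_add]; exact Submodule.mul_mem_mul hm hn⟩
  | add a b ha hb =>
    obtain ⟨m, hm⟩ := ha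
    obtain ⟨n, hn⟩ := hb
    exact ⟨max m n, add_mem (pow_le_pow_right₀ hone (le_max_left m n) hm)
      (pow_le_pow_right₀ hone (le_max_right m n) hn)⟩

theorem span_pow_freeLie :
    Submodule.span ℂ {z | ∃ x ∈ freeLie V, ∃ n : ℕ, z = x ^ n} = ⊤ := by
  refine eq_top_iff.2 fun z _ => ?_
  obtain ⟨n, hn⟩ := exists_mem_one_sup_freeLie_pow z
  refine Submodule.span_mono ?_ (one_sup_pow_le_powSpan _ n hn)
  rintro _ ⟨x, hx, m, _, h⟩
  exact ⟨x, hx, m, h⟩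

/-! ### Homogeneous components -/

/-- The homogeneous component of degree `k` of an element of the tensor algebra. -/
def homogeneousPart (k : ℕ) : TensorAlgebra ℂ V →ₗ[ℂ] ⨂[ℂ]^k V :=
  DirectSum.component ℂ ℕ (fun n => ⨂[ℂ]^n V) k ∘ₗ TensorAlgebra.toDirectSum.toLinearMap

theorem toDirectSum_toTensorAlgebra {k : ℕ} (t : ⨂[ℂ]^k V) :
    TensorAlgebra.toDirectSum (TensorPower.toTensorAlgebra t) =
      DirectSum.of (fun n => ⨂[ℂ]^n V) k t := by
  rw [← TensorAlgebra.toDirectSum_ofDirectSum (DirectSum.of (fun n => ⨂[ℂ]^n V) k t)]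
  congr 1
  exact (DirectSum.toAddMonoid_of
    (fun _ ↦ LinearMap.toAddMonoidHom TensorPower.toTensorAlgebra) _ _).symm

@[simp]
theorem homogeneousPart_toTensorAlgebra {k : ℕ} (t : ⨂[ℂ]^k V) :
    homogeneousPart k (TensorPower.toTensorAlgebra t) = t := by
  rw [homogeneousPart, LinearMap.comp_apply, AlgHom.toLinearMap_apply,
    toDirectSum_toTensorAlgebra]
  exact DirectSum.of_eq_same (β := fun n => ⨂[ℂ]^n V) k t

theorem homogeneousPart_toTensorAlgebra_of_ne {j k : ℕ} (h : j ≠ k) (t : ⨂[ℂ]^j V) :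
    homogeneousPart k (TensorPower.toTensorAlgebra t) = 0 := by
  rw [homogeneousPart, LinearMap.comp_apply, AlgHom.toLinearMap_apply,
    toDirectSum_toTensorAlgebra]
  exact DirectSum.of_eq_of_ne (β := fun n => ⨂[ℂ]^n V) j k t h.symm

theorem list_prod_mem_range (T : (i : ℕ) → ⨂[ℂ]^i V) (α : List ℕ) :
    (α.map fun i => TensorPower.toTensorAlgebra (T i)).prod ∈
      LinearMap.range (TensorPower.toTensorAlgebra (R := ℂ) (M := V) (n := α.sum)) := by
  induction α with
  | nil => exact ⟨_, TensorPower.toTensorAlgebra_gOne⟩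
  | cons i α ih =>
    obtain ⟨t, ht⟩ := ih
    rw [List.map_cons, List.prod_cons, ← ht, List.sum_cons]
    exact ⟨_, TensorPower.toTensorAlgebra_gMul (T i) t⟩

theorem symSum_mem_range (T : (i : ℕ) → ⨂[ℂ]^i V) (s : Multiset ℕ) :
    symSum (fun i => TensorPower.toTensorAlgebra (T i)) s ∈
      LinearMap.range (TensorPower.toTensorAlgebra (R := ℂ) (M := V) (n := s.sum)) := by
  refine sum_mem fun α hα => ?_
  have h : s = (α : Multiset ℕ) := by simpa [Multiset.mem_lists_iff] using hα
  subst h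
  rw [Multiset.sum_coe]
  exact list_prod_mem_range T α

/-- The span of the homogeneous Lie elements of positive degree. -/
def homogeneousLie (V : Type*) [AddCommGroup V] [Module ℂ V] :
    Submodule ℂ (TensorAlgebra ℂ V) :=
  Submodule.span ℂ {z | ∃ (k : ℕ) (t : ⨂[ℂ]^k V), 0 < k ∧ t ∈ liePart V k ∧
    z = TensorPower.toTensorAlgebra t}

theorem lie_mem_homogeneousLie {x y : TensorAlgebra ℂ V} (hx : x ∈ homogeneousLie V)
    (hy : y ∈ homogeneousLie V) : ⁅x, y⁆ ∈ homogeneousLie V := by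
  induction hx using Submodule.span_induction with
  | zero => simp
  | add a b _ _ ha hb => rw [add_lie]; exact add_mem ha hb
  | smul c a _ ha => rw [smul_lie]; exact Submodule.smul_mem _ c ha
  | mem x hx =>
    obtain ⟨k, s, hk, hs, rfl⟩ := hx
    induction hy using Submodule.span_induction with
    | zero => simp
    | add a b _ _ ha hb => rw [lie_add]; exact add_mem ha hb
    | smul c a _ ha => rw [lie_smul]; exact Submodule.smul_mem _ c ha
    | mem y hy =>
      obtain ⟨l, t, hl, ht, rfl⟩ := hy
      -- The two products live in degrees `k + l` and `l + k`, distinct as types; a common `m`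
      -- allows their subtraction.
      have key : ∀ m, k + l = m → l + k = m → ∃ r : ⨂[ℂ]^m V, TensorPower.toTensorAlgebra r =
          ⁅(TensorPower.toTensorAlgebra s : TensorAlgebra ℂ V), TensorPower.toTensorAlgebra t⁆ := by
        intro m h1 h2
        obtain ⟨r₁, hr₁⟩ : ∃ r : ⨂[ℂ]^m V, TensorPower.toTensorAlgebra r =
            TensorPower.toTensorAlgebra s * TensorPower.toTensorAlgebra t := by
          subst h1; exact ⟨_, TensorPower.toTensorAlgebra_gMul s t⟩
        obtain ⟨r₂, hr₂⟩ : ∃ r : ⨂[ℂ]^m V, TensorPower.toTensorAlgebra r =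
            TensorPower.toTensorAlgebra t * TensorPower.toTensorAlgebra s := by
          subst h2; exact ⟨_, TensorPower.toTensorAlgebra_gMul t s⟩
        exact ⟨r₁ - r₂, by rw [map_sub, hr₁, hr₂, Ring.lie_def]⟩
      obtain ⟨r, hr⟩ := key (k + l) rfl (add_comm l k)
      refine Submodule.subset_span ⟨k + l, r, by omega, ?_, hr.symm⟩
      change TensorPower.toTensorAlgebra r ∈ freeLie V
      rw [hr]
      exact (freeLie V).lie_mem hs ht

/-- The span of homogeneous Lie elements contains `V` and is closed under the bracket. -/
theorem freeLie_le_homogeneousLie {x : TensorAlgebra ℂ V} (hx : x ∈ freeLie V) :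
    x ∈ homogeneousLie V := by
  let K : LieSubalgebra ℂ (TensorAlgebra ℂ V) :=
    { homogeneousLie V with lie_mem' := fun hx hy => lie_mem_homogeneousLie hx hy }
  have h : freeLie V ≤ K := by
    refine LieSubalgebra.lieSpan_le.2 ?_
    rintro _ ⟨v, rfl⟩
    have hv : TensorPower.toTensorAlgebra (PiTensorProduct.tprod ℂ fun _ : Fin 1 => v) =
        TensorAlgebra.ι ℂ v := by simp
    refine Submodule.subset_span ⟨1, _, one_pos, ?_, hv.symm⟩
    change TensorPower.toTensorAlgebra _ ∈ freeLie V
    rw [hv]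
    exact ι_mem_freeLie v
  exact h hx

theorem exists_eq_sum_toTensorAlgebra {x : TensorAlgebra ℂ V} (hx : x ∈ homogeneousLie V) :
    ∃ (T : (i : ℕ) → ⨂[ℂ]^i V) (I : Finset ℕ), (∀ i, T i ∈ liePart V i) ∧
      (∀ i ∉ I, T i = 0) ∧ 0 ∉ I ∧ x = ∑ i ∈ I, TensorPower.toTensorAlgebra (T i) := by
  induction hx using Submodule.span_induction with
  | zero => exact ⟨0, ∅, fun i => zero_mem _, fun i _ => rfl, by simp, by simp⟩
  | smul c a _ ha =>
    obtain ⟨T, I, h1, h2, h3, rfl⟩ := ha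
    exact ⟨c • T, I, fun i => Submodule.smul_mem _ c (h1 i), fun i hi => by simp [h2 i hi], h3,
      by simp [Finset.smul_sum]⟩
  | add a b _ _ ha hb =>
    obtain ⟨T, I, h1, h2, h3, rfl⟩ := ha
    obtain ⟨S, J, k1, k2, k3, rfl⟩ := hb
    refine ⟨T + S, I ∪ J, fun i => add_mem (h1 i) (k1 i), fun i hi => ?_, by simp [h3, k3], ?_⟩
    · rw [Finset.mem_union, not_or] at hi
      simp [h2 i hi.1, k2 i hi.2]
    · simp only [Pi.add_apply, map_add, Finset.sum_add_distrib]
      congr 1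
      · exact Finset.sum_subset Finset.subset_union_left fun i _ hi => by rw [h2 i hi, map_zero]
      · exact Finset.sum_subset Finset.subset_union_right fun i _ hi => by rw [k2 i hi, map_zero]
  | mem x hx =>
    obtain ⟨k, t, hk, ht, rfl⟩ := hx
    refine ⟨Pi.single k t, {k}, fun i => ?_, fun i hi => ?_, by simp; omega, by simp⟩
    · by_cases h : i = k
      · subst h; simpa using ht
      · rw [Pi.single_eq_of_ne h]; exact zero_mem _
    · exact Pi.single_eq_of_ne (by simpa using hi) _

theorem span_symSum_liePart :
    Submodule.span ℂ {z | ∃ T : (i : ℕ) → ⨂[ℂ]^i V, (∀ i, T i ∈ liePart V i) ∧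
      ∃ s : Multiset ℕ, 0 ∉ s ∧ z = symSum (fun i => TensorPower.toTensorAlgebra (T i)) s} = ⊤ := by
  rw [eq_top_iff, ← span_pow_freeLie, Submodule.span_le]
  rintro _ ⟨x, hx, n, rfl⟩
  obtain ⟨T, I, h1, -, h3, rfl⟩ := exists_eq_sum_toTensorAlgebra (freeLie_le_homogeneousLie hx)
  rw [sum_pow_eq_sum_symSum]
  refine sum_mem fun s hs => Submodule.subset_span ⟨T, h1, s, fun h0 => h3 ?_, rfl⟩
  exact (mem_multisetsOfCard.1 hs).2 0 h0

theorem mem_thrallModule {k : ℕ} (p : k.Partition) {t : ⨂[ℂ]^k V} {T : (i : ℕ) → ⨂[ℂ]^i V}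
    (hT : ∀ i, T i ∈ liePart V i)
    (ht : TensorPower.toTensorAlgebra t =
      symSum (fun i => TensorPower.toTensorAlgebra (T i)) p.parts) : t ∈ thrallModule V p :=
  Submodule.subset_span ⟨T, hT, ht⟩

/-! ### The unshuffle coproduct -/

/-- The coproduct of the tensor algebra for which the vectors are primitive. -/
def comul : TensorAlgebra ℂ V →ₐ[ℂ] TensorAlgebra ℂ V ⊗[ℂ] TensorAlgebra ℂ V :=
  TensorAlgebra.lift ℂ
    ((TensorProduct.mk ℂ (TensorAlgebra ℂ V) (TensorAlgebra ℂ V)).flip 1 ∘ₗ TensorAlgebra.ι ℂ +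
      TensorProduct.mk ℂ (TensorAlgebra ℂ V) (TensorAlgebra ℂ V) 1 ∘ₗ TensorAlgebra.ι ℂ)

@[simp]
theorem comul_ι (v : V) : comul (TensorAlgebra.ι ℂ v) =
    TensorAlgebra.ι ℂ v ⊗ₜ[ℂ] (1 : TensorAlgebra ℂ V) + 1 ⊗ₜ[ℂ] TensorAlgebra.ι ℂ v := by
  simp [comul]

/-- Primitive elements are closed under commutators, since the mixed terms cancel. -/
theorem comul_of_mem_freeLie {x : TensorAlgebra ℂ V} (hx : x ∈ freeLie V) :
    comul x = x ⊗ₜ[ℂ] (1 : TensorAlgebra ℂ V) + 1 ⊗ₜ[ℂ] x := by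
  induction hx using LieSubalgebra.lieSpan_induction with
  | mem x hx =>
    obtain ⟨v, rfl⟩ := hx
    exact comul_ι v
  | zero => simp
  | add x y _ _ hx hy =>
    rw [map_add, hx, hy, TensorProduct.add_tmul, TensorProduct.tmul_add]
    abel
  | smul c x _ hx =>
    rw [map_smul, hx, smul_add, TensorProduct.smul_tmul', TensorProduct.tmul_smul]
  | lie x y _ _ hx hy =>
    rw [Ring.lie_def, map_sub, map_mul, map_mul, hx, hy]
    simp only [mul_add, add_mul, Algebra.TensorProduct.tmul_mul_tmul, mul_one, one_mul,
      TensorProduct.sub_tmul, TensorProduct.tmul_sub]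
    abel

theorem comul_symSum {U : ℕ → TensorAlgebra ℂ V} (hU : ∀ i, U i ∈ freeLie V) (s : Multiset ℕ) :
    comul (symSum U s) = ∑ x ∈ splits s,
      s.card.choose x.1.card • (symSum U x.1 ⊗ₜ[ℂ] symSum U x.2) := by
  have h := symSum_add (fun i => U i ⊗ₜ[ℂ] (1 : TensorAlgebra ℂ V))
    (fun i => (1 : TensorAlgebra ℂ V) ⊗ₜ[ℂ] U i)
    (fun i j => by simp [Commute, SemiconjBy]) s
  have h1 := map_symSum (comul (V := V)).toRingHom U s
  have hl (a) := map_symSum (Algebra.TensorProduct.includeLeft (R := ℂ) (S := ℂ)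
    (A := TensorAlgebra ℂ V) (B := TensorAlgebra ℂ V)).toRingHom U a
  have hr (a) := map_symSum (Algebra.TensorProduct.includeRight (R := ℂ)
    (A := TensorAlgebra ℂ V) (B := TensorAlgebra ℂ V)).toRingHom U a
  simp only [AlgHom.toRingHom_eq_coe, RingHom.coe_coe, Algebra.TensorProduct.includeLeft_apply,
    Algebra.TensorProduct.includeRight_apply] at h1 hl hr
  rw [h1, funext fun i => comul_of_mem_freeLie (hU i), h]
  refine Finset.sum_congr rfl fun x _ => ?_
  rw [← hl, ← hr, Algebra.TensorProduct.tmul_mul_tmul, one_mul, mul_one]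

/-- The convolution product of two endomorphisms of the tensor algebra. -/
def convolution (f g : TensorAlgebra ℂ V →ₗ[ℂ] TensorAlgebra ℂ V) :
    TensorAlgebra ℂ V →ₗ[ℂ] TensorAlgebra ℂ V :=
  LinearMap.mul' ℂ _ ∘ₗ TensorProduct.map f g ∘ₗ comul.toLinearMap

theorem convolution_symSum (f g : TensorAlgebra ℂ V →ₗ[ℂ] TensorAlgebra ℂ V)
    {U : ℕ → TensorAlgebra ℂ V} (hU : ∀ i, U i ∈ freeLie V) (s : Multiset ℕ) :
    convolution f g (symSum U s) = ∑ x ∈ splits s,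
      s.card.choose x.1.card • (f (symSum U x.1) * g (symSum U x.2)) := by
  rw [convolution, LinearMap.comp_apply, LinearMap.comp_apply, AlgHom.toLinearMap_apply,
    comul_symSum hU]
  simp only [map_sum, map_nsmul, TensorProduct.map_tmul, LinearMap.mul'_apply]

/-! ### Projections onto the symmetric products -/

/-- The second Adams operation of the tensor algebra. -/
def adams : Module.End ℂ (TensorAlgebra ℂ V) :=
  convolution LinearMap.id LinearMap.id

theorem symSum_mem_eigenspace {U : ℕ → TensorAlgebra ℂ V} (hU : ∀ i, U i ∈ freeLie V)
    (s : Multiset ℕ) : symSum U s ∈ adams.eigenspace ((2 : ℂ) ^ s.card) := by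
  rw [Module.End.mem_eigenspace_iff, adams, convolution_symSum _ _ hU]
  simp only [LinearMap.id_apply]
  rw [sum_splits_choose_symSum_mul, ← Nat.cast_smul_eq_nsmul ℂ]
  simp

/-- The numbers `2 ^ n` are distinct, so the eigenspaces are independent; they span because
symmetrized products are eigenvectors. -/
theorem isInternal_eigenspace_adams : DirectSum.IsInternal
    fun n : ℕ => (adams (V := V)).eigenspace ((2 : ℂ) ^ n) := by
  refine DirectSum.isInternal_submodule_of_iSupIndep_of_iSup_eq_top ?_ ?_
  · refine (adams (V := V)).eigenspaces_iSupIndep.comp (f := fun n : ℕ => (2 : ℂ) ^ n) ?_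
    intro m n h
    have h : (2 : ℂ) ^ m = 2 ^ n := h
    exact Nat.pow_right_injective le_rfl (by exact_mod_cast h)
  · rw [eq_top_iff, ← span_symSum_liePart, Submodule.span_le]
    rintro _ ⟨T, hT, s, -, rfl⟩
    exact Submodule.mem_iSup_of_mem s.card (symSum_mem_eigenspace hT s)

/-- The projection onto the eigenspace `2 ^ n` of the second Adams operation. -/
def eulerianProj (n : ℕ) : TensorAlgebra ℂ V →ₗ[ℂ] TensorAlgebra ℂ V :=
  Submodule.subtype _ ∘ₗ
    DirectSum.component ℂ ℕ (fun n : ℕ => (adams (V := V)).eigenspace ((2 : ℂ) ^ n)) n ∘ₗ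
    (LinearEquiv.ofBijective (DirectSum.coeLinearMap _)
      isInternal_eigenspace_adams).symm.toLinearMap

theorem eulerianProj_symSum {U : ℕ → TensorAlgebra ℂ V} (hU : ∀ i, U i ∈ freeLie V)
    (n : ℕ) (s : Multiset ℕ) :
    eulerianProj n (symSum U s) = if s.card = n then symSum U s else 0 := by
  have hs := symSum_mem_eigenspace hU s
  split_ifs with h
  · subst h
    exact congrArg Subtype.val (isInternal_eigenspace_adams.ofBijective_coeLinearMap_of_mem hs)
  · exact congrArg Subtype.val
      (isInternal_eigenspace_adams.ofBijective_coeLinearMap_of_mem_ne h hs)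

/-- The projection onto the Lie elements of degree `i` along the symmetric products of
several Lie elements and the Lie elements of the other degrees. -/
def lieProj (i : ℕ) : TensorAlgebra ℂ V →ₗ[ℂ] TensorAlgebra ℂ V :=
  TensorPower.toTensorAlgebra ∘ₗ homogeneousPart i ∘ₗ eulerianProj 1

theorem lieProj_symSum {T : (i : ℕ) → ⨂[ℂ]^i V} (hT : ∀ i, T i ∈ liePart V i)
    (i : ℕ) (s : Multiset ℕ) :
    lieProj i (symSum (fun i => TensorPower.toTensorAlgebra (T i)) s) =
      if s = {i} then TensorPower.toTensorAlgebra (T i) else 0 := by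
  rw [lieProj, LinearMap.comp_apply, LinearMap.comp_apply, eulerianProj_symSum hT]
  by_cases h : s.card = 1
  · obtain ⟨j, rfl⟩ := Multiset.card_eq_one.1 h
    rw [if_pos h, symSum_singleton]
    by_cases hij : j = i
    · subst hij
      simp
    · rw [homogeneousPart_toTensorAlgebra_of_ne hij, if_neg (by simpa using hij), map_zero]
  · rw [if_neg h, map_zero, map_zero, if_neg (by rintro rfl; simp at h)]

/-- The convolution of the projections onto the Lie elements of the degrees in a list. -/
def lieConvolution : List ℕ → (TensorAlgebra ℂ V →ₗ[ℂ] TensorAlgebra ℂ V)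
  | [] => eulerianProj 0
  | i :: α => convolution (lieProj i) (lieConvolution α)

/-- Each convolution extracts one Lie factor: only the splitting `({i}, α)` survives, with
coefficient `s.card.choose 1 = s.card`. These coefficients multiply to the factorial that
`thrallProj` divides out. -/
theorem lieConvolution_symSum {T : (i : ℕ) → ⨂[ℂ]^i V} (hT : ∀ i, T i ∈ liePart V i)
    (α : List ℕ) (s : Multiset ℕ) :
    lieConvolution α (symSum (fun i => TensorPower.toTensorAlgebra (T i)) s) =
      if (α : Multiset ℕ) = s then
        s.card.factorial • (α.map fun i => TensorPower.toTensorAlgebra (T i)).prod else 0 := by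
  induction α generalizing s with
  | nil =>
    rw [lieConvolution, eulerianProj_symSum hT]
    by_cases h : s = 0
    · simp [h]
    · rw [if_neg (by simpa using h), if_neg (by simpa [eq_comm] using h)]
  | cons i α ih =>
    rw [lieConvolution, convolution_symSum _ _ hT]
    simp only [lieProj_symSum hT, ih]
    by_cases h : (α : Multiset ℕ) + {i} = s
    · have hs : ((i :: α : List ℕ) : Multiset ℕ) = s := by
        rw [← h, ← Multiset.cons_coe, add_comm, Multiset.singleton_add]
      rw [Finset.sum_eq_single ({i}, (α : Multiset ℕ)), if_pos hs]
      · have hc : s.card = α.length + 1 := by rw [← h]; simp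
        rw [hc, if_pos rfl, if_pos rfl, Multiset.card_singleton, Multiset.coe_card,
          Nat.choose_one_right, mul_smul_comm, Nat.factorial_succ, mul_smul, List.map_cons,
          List.prod_cons]
      · rintro ⟨a, b⟩ hx hne
        by_cases ha : a = {i}
        · subst ha
          rw [if_neg (c := (α : Multiset ℕ) = b) (by rintro rfl; exact hne rfl), mul_zero,
            smul_zero]
        · rw [if_neg (c := a = {i}) ha, zero_mul, smul_zero]
      · intro hx
        exact absurd (by rw [mem_splits, add_comm]; exact h) hx
    · rw [if_neg fun hs => h (by
        rw [← hs, ← Multiset.cons_coe, add_comm, Multiset.singleton_add])]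
      refine Finset.sum_eq_zero ?_
      rintro ⟨a, b⟩ hx
      rw [mem_splits] at hx
      by_cases ha : a = {i}
      · rw [if_neg (c := (α : Multiset ℕ) = b) (by
          rintro rfl; exact h (by rw [← hx, ha, add_comm])), mul_zero, smul_zero]
      · rw [if_neg (c := a = {i}) ha, zero_mul, smul_zero]

/-- The projection onto the symmetric products of Lie elements whose degrees form the
multiset `s`. -/
def thrallProj (s : Multiset ℕ) : TensorAlgebra ℂ V →ₗ[ℂ] TensorAlgebra ℂ V :=
  ((s.card.factorial : ℂ)⁻¹) • ∑ α ∈ s.lists.toFinset, lieConvolution α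

theorem thrallProj_symSum {T : (i : ℕ) → ⨂[ℂ]^i V} (hT : ∀ i, T i ∈ liePart V i)
    (r s : Multiset ℕ) :
    thrallProj r (symSum (fun i => TensorPower.toTensorAlgebra (T i)) s) =
      if s = r then symSum (fun i => TensorPower.toTensorAlgebra (T i)) s else 0 := by
  have hr : ∀ α ∈ r.lists.toFinset, (α : Multiset ℕ) = r := fun α hα => by
    simpa [Multiset.mem_lists_iff, eq_comm] using hα
  rw [thrallProj, LinearMap.smul_apply, LinearMap.sum_apply]
  simp only [lieConvolution_symSum hT]
  split_ifs with h
  · subst h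
    rw [Finset.sum_congr rfl fun α hα => if_pos (hr α hα), ← Finset.smul_sum,
      ← Nat.cast_smul_eq_nsmul ℂ, smul_smul,
      inv_mul_cancel₀ (by exact_mod_cast s.card.factorial_ne_zero), one_smul]
    rfl
  · rw [Finset.sum_eq_zero, smul_zero]
    intro α hα
    rw [if_neg]
    rw [hr α hα]
    exact fun h' => h h'.symm

/-! ### The shuffle product is dual to the unshuffle coproduct -/

/-- Every letter goes to the left or the right tensor factor. Letters are indexed by distinct
positions, so the choices are subsets even if vectors repeat. -/
theorem comul_list_prod {κ : Type*} [DecidableEq κ] (v : κ → V) {l : List κ} (hl : l.Nodup) :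
    comul (l.map fun i => TensorAlgebra.ι ℂ (v i)).prod = ∑ s ∈ l.toFinset.powerset,
      ((l.filter (· ∈ s)).map fun i => TensorAlgebra.ι ℂ (v i)).prod ⊗ₜ[ℂ]
        ((l.filter (· ∉ s)).map fun i => TensorAlgebra.ι ℂ (v i)).prod := by
  induction l with
  | nil => simp [Algebra.TensorProduct.one_def]
  | cons a l ih =>
    obtain ⟨ha, hl⟩ := List.nodup_cons.1 hl
    rw [List.map_cons, List.prod_cons, map_mul, comul_ι, ih hl, add_mul, List.toFinset_cons,
      Finset.sum_powerset_insert (by simpa using ha), add_comm, Finset.mul_sum, Finset.mul_sum]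
    congr 1
    · refine Finset.sum_congr rfl fun s hs => ?_
      have has : a ∉ s := fun h => ha (List.mem_toFinset.1 (Finset.mem_powerset.1 hs h))
      simp [has]
    · refine Finset.sum_congr rfl fun s hs => ?_
      have h1 : l.filter (· ∈ insert a s) = l.filter (· ∈ s) :=
        List.filter_congr fun i hi => by
          have : i ≠ a := by rintro rfl; exact ha hi
          simp [this]
      have h2 : l.filter (· ∉ insert a s) = l.filter (· ∉ s) :=
        List.filter_congr fun i hi => by
          have : i ≠ a := by rintro rfl; exact ha hi
          simp [this]
      rw [List.filter_cons_of_pos (by simp), List.filter_cons_of_neg (by simp), h1, h2]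
      simp

/-- The word of the vectors `v i`, `i ∈ s`, in increasing order of `i`. -/
def subword {m : ℕ} (v : Fin m → V) (s : Finset (Fin m)) : TensorAlgebra ℂ V :=
  (((List.finRange m).filter (· ∈ s)).map fun i => TensorAlgebra.ι ℂ (v i)).prod

theorem comul_tprod {m : ℕ} (v : Fin m → V) :
    comul (TensorAlgebra.tprod ℂ V m v) =
      ∑ s : Finset (Fin m), subword v s ⊗ₜ[ℂ] subword v sᶜ := by
  rw [TensorAlgebra.tprod_apply, List.ofFn_eq_map, comul_list_prod v (List.nodup_finRange m)]
  have h : (List.finRange m).toFinset.powerset = Finset.univ := by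
    ext s
    simp
  rw [h]
  refine Finset.sum_congr rfl fun s _ => ?_
  simp [subword]

theorem filter_finRange_eq_map_orderEmbOfFin {m k : ℕ} (s : Finset (Fin m)) (h : s.card = k) :
    (List.finRange m).filter (· ∈ s) = (List.finRange k).map (s.orderEmbOfFin h) := by
  rw [Finset.listMap_orderEmbOfFin_finRange]
  have h1 : ((List.finRange m).filter (· ∈ s)).toFinset = s := by
    ext i
    simp
  have h2 := (List.toFinset_sort (· ≤ ·) ((List.nodup_finRange m).filter (· ∈ s))).2
    ((List.pairwise_le_finRange m).filter _)
  rw [h1] at h2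
  exact h2.symm

theorem subword_eq {m k : ℕ} (v : Fin m → V) (s : Finset (Fin m)) (h : s.card = k) :
    subword v s = TensorPower.toTensorAlgebra
      (PiTensorProduct.tprod ℂ fun a => v (s.orderEmbOfFin h a)) := by
  rw [subword, filter_finRange_eq_map_orderEmbOfFin s h, TensorPower.toTensorAlgebra_tprod,
    TensorAlgebra.tprod_apply, List.ofFn_eq_map, List.map_map]
  rfl

/-- The linear function on the tensor algebra given by an element of its graded dual. -/
def pairing : ShuffleAlgebra V →ₗ[ℂ] Module.Dual ℂ (TensorAlgebra ℂ V) :=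
  DirectSum.toModule ℂ ℕ _ fun k => (homogeneousPart k).dualMap

theorem pairing_lof (k : ℕ) (b : Module.Dual ℂ (⨂[ℂ]^k V)) (z : TensorAlgebra ℂ V) :
    pairing (DirectSum.lof ℂ ℕ (fun m => Module.Dual ℂ (⨂[ℂ]^m V)) k b) z =
      b (homogeneousPart k z) := by
  simp [pairing]

theorem pairing_toTensorAlgebra (β : ShuffleAlgebra V) {k : ℕ} (t : ⨂[ℂ]^k V) :
    pairing β (TensorPower.toTensorAlgebra t) = β k t := by
  induction β using DirectSum.induction_on with
  | zero => simp
  | add a b ha hb => rw [map_add, LinearMap.add_apply, ha, hb]; rfl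
  | of j b =>
    rw [← DirectSum.lof_eq_of ℂ, pairing_lof]
    by_cases h : j = k
    · subst h
      rw [homogeneousPart_toTensorAlgebra, DirectSum.lof_apply]
    · rw [homogeneousPart_toTensorAlgebra_of_ne (Ne.symm h), map_zero, DirectSum.lof_eq_of,
        DirectSum.of_eq_of_ne _ _ _ (Ne.symm h)]
      rfl

theorem linearMap_ext_tprod {M : Type*} [AddCommGroup M] [Module ℂ M]
    {f g : TensorAlgebra ℂ V →ₗ[ℂ] M}
    (h : ∀ (m : ℕ) (v : Fin m → V),
      f (TensorAlgebra.tprod ℂ V m v) = g (TensorAlgebra.tprod ℂ V m v)) : f = g := by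
  have key : f ∘ₗ TensorAlgebra.ofDirectSum.toLinearMap =
      g ∘ₗ TensorAlgebra.ofDirectSum.toLinearMap := by
    refine DirectSum.linearMap_ext _ fun m => PiTensorProduct.ext <| MultilinearMap.ext fun v => ?_
    simpa [DirectSum.lof_eq_of] using h m v
  refine LinearMap.ext fun z => ?_
  simpa using LinearMap.congr_fun key (TensorAlgebra.toDirectSum z)

/-- On a word of length `m` both sides sum over sets of positions; for degree reasons only sets of
size `k` count, and only when `k + l = m`. -/
theorem pairing_shuffle_lof {k l : ℕ} (b : Module.Dual ℂ (⨂[ℂ]^k V))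
    (c : Module.Dual ℂ (⨂[ℂ]^l V)) :
    pairing (shuffle (DirectSum.lof ℂ ℕ (fun m => Module.Dual ℂ (⨂[ℂ]^m V)) k b)
        (DirectSum.lof ℂ ℕ (fun m => Module.Dual ℂ (⨂[ℂ]^m V)) l c)) =
      LinearMap.mul' ℂ ℂ ∘ₗ TensorProduct.map
        (pairing (DirectSum.lof ℂ ℕ (fun m => Module.Dual ℂ (⨂[ℂ]^m V)) k b))
        (pairing (DirectSum.lof ℂ ℕ (fun m => Module.Dual ℂ (⨂[ℂ]^m V)) l c)) ∘ₗ
        comul.toLinearMap := by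
  refine linearMap_ext_tprod fun m v => ?_
  rw [shuffle_lof, LinearMap.comp_apply, LinearMap.comp_apply, AlgHom.toLinearMap_apply,
    comul_tprod, map_sum, map_sum]
  simp only [TensorProduct.map_tmul, LinearMap.mul'_apply, pairing_lof]
  rw [← TensorPower.toTensorAlgebra_tprod]
  have hne {n : ℕ} (s : Finset (Fin m)) (h : s.card ≠ n) :
      homogeneousPart n (subword v s) = 0 := by
    rw [subword_eq v s rfl, homogeneousPart_toTensorAlgebra_of_ne h]
  by_cases hm : k + l = m
  · subst hm
    rw [homogeneousPart_toTensorAlgebra, shuffleHom_tprod]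
    rw [← Finset.sum_filter_of_ne (s := Finset.univ)
      (p := fun s : Finset (Fin (k + l)) => s.card = k) (fun s _ h => by
        by_contra hs
        exact h (by rw [hne s hs, map_zero, zero_mul])),
      Finset.sum_subtype (p := fun s : Finset (Fin (k + l)) => s.card = k) _ (by simp)]
    refine Finset.sum_congr rfl fun s _ => ?_
    rw [subword_eq v s.1 s.2, subword_eq v _ (card_compl_eq s), homogeneousPart_toTensorAlgebra,
      homogeneousPart_toTensorAlgebra]
  · rw [homogeneousPart_toTensorAlgebra_of_ne (Ne.symm hm), map_zero, Finset.sum_eq_zero]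
    intro s _
    by_cases hs : s.card = k
    · rw [hne sᶜ (n := l) (by
        have := Finset.card_add_card_compl s
        rw [Fintype.card_fin] at this
        omega), map_zero, mul_zero]
    · rw [hne s hs, map_zero, zero_mul]

theorem pairing_shuffle (β γ : ShuffleAlgebra V) :
    pairing (shuffle β γ) =
      LinearMap.mul' ℂ ℂ ∘ₗ TensorProduct.map (pairing β) (pairing γ) ∘ₗ comul.toLinearMap := by
  induction β using DirectSum.induction_on with
  | zero => simp
  | add a b ha hb =>
    rw [map_add, LinearMap.add_apply, map_add, ha, hb, map_add, TensorProduct.map_add_left,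
      LinearMap.add_comp, LinearMap.comp_add]
  | of k b =>
    induction γ using DirectSum.induction_on with
    | zero => simp
    | add c d hc hd =>
      rw [map_add, map_add, hc, hd, map_add, TensorProduct.map_add_right,
        LinearMap.add_comp, LinearMap.comp_add]
    | of l c => exact pairing_shuffle_lof b c

/-! ### The grading by partitions -/

/-- Replaces partitions of varying integers by multisets without `0`, each a partition of its own
sum, so that the formulas for `symSum` apply. -/
theorem mem_dualThrallModule_iff {k : ℕ} (p : k.Partition) (β : ShuffleAlgebra V) :
    β ∈ dualThrallModule V p ↔ ∀ T : (i : ℕ) → ⨂[ℂ]^i V, (∀ i, T i ∈ liePart V i) →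
      ∀ s : Multiset ℕ, 0 ∉ s → s ≠ p.parts →
        pairing β (symSum (fun i => TensorPower.toTensorAlgebra (T i)) s) = 0 := by
  constructor
  · intro h T hT s hs hsp
    obtain ⟨r, hr⟩ := symSum_mem_range T s
    rw [← hr, pairing_toTensorAlgebra]
    let q : s.sum.Partition := ⟨s, fun {i} hi => Nat.pos_of_ne_zero fun h => hs (h ▸ hi), rfl⟩
    exact h _ q hsp r (mem_thrallModule q hT hr)
  · intro h m q hq t ht
    have h1 : thrallModule V q ≤ LinearMap.ker (β m) := by
      refine Submodule.span_le.2 ?_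
      rintro t ⟨T, hT, ht⟩
      change β m t = 0
      rw [← pairing_toTensorAlgebra, ht]
      exact h T hT q.parts (fun h0 => lt_irrefl 0 (q.parts_pos h0)) hq
    exact h1 ht

theorem shuffle_mem_dualThrallModule {k l : ℕ} (p : k.Partition) (q : l.Partition)
    {β γ : ShuffleAlgebra V} (hβ : β ∈ dualThrallModule V p) (hγ : γ ∈ dualThrallModule V q) :
    shuffle β γ ∈ dualThrallModule V (partitionUnion p q) := by
  rw [mem_dualThrallModule_iff] at hβ hγ ⊢
  intro T hT s hs hsp
  rw [pairing_shuffle, LinearMap.comp_apply, LinearMap.comp_apply, AlgHom.toLinearMap_apply,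
    comul_symSum hT]
  simp only [map_sum, map_nsmul, TensorProduct.map_tmul, LinearMap.mul'_apply]
  refine Finset.sum_eq_zero ?_
  rintro ⟨a, b⟩ hx
  rw [mem_splits] at hx
  dsimp only at hx ⊢
  by_cases ha : a = p.parts
  · have hb : b ≠ q.parts := by
      rintro rfl
      exact hsp (by rw [← hx, ha]; rfl)
    rw [hγ T hT b (fun h => hs (by rw [← hx]; exact Multiset.mem_add.2 (Or.inr h))) hb,
      mul_zero, smul_zero]
  · rw [hβ T hT a (fun h => hs (by rw [← hx]; exact Multiset.mem_add.2 (Or.inl h))) ha,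
      zero_mul, smul_zero]

theorem shuffleOne_mem_dualThrallModule :
    shuffleOne V ∈ dualThrallModule V (default : Nat.Partition 0) := by
  intro m q hq t _
  have hm : m ≠ 0 := by
    rintro rfl
    exact hq (congrArg Nat.Partition.parts (Subsingleton.elim q default))
  rw [shuffleOne, DirectSum.lof_eq_of, DirectSum.of_eq_of_ne _ _ _ hm]
  rfl

theorem eq_zero_of_pairing_symSum_eq_zero {β : ShuffleAlgebra V}
    (h : ∀ T : (i : ℕ) → ⨂[ℂ]^i V, (∀ i, T i ∈ liePart V i) → ∀ s : Multiset ℕ, 0 ∉ s →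
      pairing β (symSum (fun i => TensorPower.toTensorAlgebra (T i)) s) = 0) : β = 0 := by
  have h1 : pairing β = 0 := by
    refine LinearMap.ker_eq_top.1 (eq_top_iff.2 ?_)
    rw [← span_symSum_liePart, Submodule.span_le]
    rintro _ ⟨T, hT, s, hs, rfl⟩
    exact h T hT s hs
  refine DFinsupp.ext fun k => LinearMap.ext fun t => ?_
  have := pairing_toTensorAlgebra β t
  rw [h1] at this
  exact this.symm

theorem iSupIndep_dualThrallModule :
    iSupIndep fun p : (Σ k : ℕ, k.Partition) => dualThrallModule V p.2 := by
  intro p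
  rw [Submodule.disjoint_def]
  intro β hβ hβ'
  refine eq_zero_of_pairing_symSum_eq_zero fun T hT s hs => ?_
  by_cases hsp : s = p.2.parts
  · have hle : (⨆ (q : Σ k : ℕ, k.Partition) (_ : q ≠ p), dualThrallModule V q.2) ≤
        LinearMap.ker (pairing.flip (symSum (fun i => TensorPower.toTensorAlgebra (T i)) s)) := by
      refine iSup₂_le fun q hq γ hγ => ?_
      refine (mem_dualThrallModule_iff q.2 γ).1 hγ T hT s hs fun h => hq ?_
      obtain ⟨k, p⟩ := p
      obtain ⟨l, q⟩ := q
      have h' : q.parts = p.parts := h.symm.trans hsp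
      obtain rfl : l = k := by rw [← q.parts_sum, ← p.parts_sum, h']
      rw [Nat.Partition.ext h']
    exact hle hβ'
  · exact (mem_dualThrallModule_iff p.2 β).1 hβ T hT s hs hsp

theorem iSup_dualThrallModule :
    ⨆ p : (Σ k : ℕ, k.Partition), dualThrallModule V p.2 = ⊤ := by
  refine eq_top_iff.2 fun β _ => ?_
  induction β using DirectSum.induction_on with
  | zero => exact zero_mem _
  | add a b ha hb => exact add_mem (ha trivial) (hb trivial)
  | of k b =>
    rw [← DirectSum.lof_eq_of ℂ]
    set L := DirectSum.lof ℂ ℕ (fun m => Module.Dual ℂ (⨂[ℂ]^m V)) k with hL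
    -- The component of `b` of type `p` is its image under the transpose of the projection onto type
    -- `p`.
    let c (p : k.Partition) : Module.Dual ℂ (⨂[ℂ]^k V) :=
      b ∘ₗ homogeneousPart k ∘ₗ thrallProj p.parts ∘ₗ TensorPower.toTensorAlgebra
    have hc (p : k.Partition) (T : (i : ℕ) → ⨂[ℂ]^i V) (hT : ∀ i, T i ∈ liePart V i)
        (s : Multiset ℕ) :
        pairing (L (c p)) (symSum (fun i => TensorPower.toTensorAlgebra (T i)) s) =
        if s = p.parts then
          pairing (L b) (symSum (fun i => TensorPower.toTensorAlgebra (T i)) s) else 0 := by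
      obtain ⟨r, hr⟩ := symSum_mem_range T s
      by_cases hk : s.sum = k
      · subst hk
        have h1 := thrallProj_symSum hT p.parts s
        rw [← hr] at h1 ⊢
        rw [pairing_lof, pairing_lof, homogeneousPart_toTensorAlgebra]
        change b (homogeneousPart s.sum (thrallProj p.parts (TensorPower.toTensorAlgebra r))) = _
        rw [h1]
        split_ifs
        · rw [homogeneousPart_toTensorAlgebra]
        · simp
      · have hsp : s ≠ p.parts := by
          rintro rfl
          exact hk p.parts_sum
        rw [if_neg hsp, ← hr, pairing_lof, homogeneousPart_toTensorAlgebra_of_ne hk, map_zero]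
    have hb : L b = ∑ p : k.Partition, L (c p) := by
      rw [← sub_eq_zero]
      refine eq_zero_of_pairing_symSum_eq_zero fun T hT s hs => ?_
      rw [map_sub, map_sum, LinearMap.sub_apply, LinearMap.sum_apply,
        Finset.sum_congr rfl fun p _ => hc p T hT s, sub_eq_zero]
      -- In degree `k` exactly one partition has parts `s`; in any other degree both sides vanish.
      by_cases hk : s.sum = k
      · let q : k.Partition := ⟨s, fun {i} hi => Nat.pos_of_ne_zero fun h => hs (h ▸ hi), hk⟩
        rw [Finset.sum_eq_single q]
        · exact (if_pos rfl).symm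
        · exact fun p _ hp => if_neg fun h => hp (Nat.Partition.ext h.symm)
        · simp
      · obtain ⟨r, hr⟩ := symSum_mem_range T s
        rw [Finset.sum_eq_zero, ← hr, pairing_lof, homogeneousPart_toTensorAlgebra_of_ne hk,
          map_zero]
        intro p _
        refine if_neg ?_
        rintro rfl
        exact hk p.parts_sum
    rw [hb]
    refine sum_mem fun p _ => Submodule.mem_iSup_of_mem
      (p := fun p : (Σ k : ℕ, k.Partition) => dualThrallModule V p.2) ⟨k, p⟩ ?_
    rw [mem_dualThrallModule_iff]
    intro T hT s _ hsp
    rw [hc p T hT s]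
    exact if_neg hsp

end Thrall

end

theorem mainTheorem4 (V : Type*) [AddCommGroup V] [Module ℂ V] [FiniteDimensional ℂ V] :
    DirectSum.IsInternal
      (fun p : (Σ k : ℕ, k.Partition) => Thrall.dualThrallModule V p.2) ∧
    Thrall.shuffleOne V ∈ Thrall.dualThrallModule V (default : Nat.Partition 0) ∧
    ∀ (k l : ℕ) (p : k.Partition) (q : l.Partition) (β γ : Thrall.ShuffleAlgebra V),
      β ∈ Thrall.dualThrallModule V p → γ ∈ Thrall.dualThrallModule V q →
        Thrall.shuffle β γ ∈ Thrall.dualThrallModule V (Thrall.partitionUnion p q) :=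
  ⟨DirectSum.isInternal_submodule_of_iSupIndep_of_iSup_eq_top
      Thrall.iSupIndep_dualThrallModule Thrall.iSup_dualThrallModule,
    Thrall.shuffleOne_mem_dualThrallModule,
    fun _ _ p q _ _ => Thrall.shuffle_mem_dualThrallModule p q⟩
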